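/- Let $l,m\ge 1$ be coprime integers. On $\mathbb R^4$ with coordinates $A=(A_1,A_2,A_3,A_4)$ consider the Poisson structure $$\{A_1,A_2\}=0,\quad \{A_1,A_3\}=-mA_4,\quad \{A_1,A_4\}=mA_3,\quad \{A_2,A_3\}=lA_4,\quad \{A_2,A_4\}=-lA_3,$$ $$\{A_4,A_3\}=\tfrac12\,(l^2A_1-m^2A_2)\,A_1^{m-1}A_2^{l-1}.$$ Its symplectic leaves are the sets of all points that can be joined to a given point by finitely many successive pieces of trajectories of Hamiltonian vector fields of smooth functions. For $E>0$ let $$\Omega=\{A\in\mathbb R^4:\ A_1\ge 0,\ A_2\ge 0,\ lA_1+mA_2=E,\ A_3^2+A_4^2=A_1^mA_2^l\}.$$ Then there is exactly one symplectic leaf $\Omega_0$ whose closure is $\Omega$. The space $\Omega$, with the topology induced from $\mathbb R^4$, has a smooth structure of a surface in which the inclusion $\Omega\hookrightarrow\mathbb R^4$ is a smooth immersion at every point of $\Omega_0$ (so that on $\Omega_0$ it is the structure of an embedded submanifold of $\mathbb R^4$), and with which $\Omega$ is diffeomorphic to the sphere $\mathbb S^2$. Moreover: - if $l=m=1$, then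 $\Omega_0=\Omega$; - if $l=1$, $m>1$, then $\Omega_0=\Omega\setminus\{(0,\frac Em,0,0)\}$; - if $l>1$, $m=1$, then $\Omega_0=\Omega\setminus\{(\frac El,0,0,0)\}$; - if $l>1$, $m>1$, then $\Omega_0=\Omega\setminus\{(0,\frac Em,0,0),(\frac El,0,0,0)\}$. -/

import Mathlib

open Set Topology Metric
open scoped Manifold ContDiff

/-- The partial derivative `∂f/∂x_j` at `x`. -/
noncomputable def partialDeriv {n : ℕ} (j : Fin n) (f : EuclideanSpace ℝ (Fin n) → ℝ)
    (x : EuclideanSpace ℝ (Fin n)) : ℝ :=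
  fderiv ℝ f x (EuclideanSpace.single j 1)

/-- A smooth Poisson structure on `ℝⁿ`, given by its components `P i j = {x_i, x_j}`:
smooth functions, skew-symmetric, and satisfying the Jacobi identity in coordinates. -/
structure PoissonStructure (n : ℕ) where
  /-- The component `{x_i, x_j}`. -/
  tensor : Fin n → Fin n → EuclideanSpace ℝ (Fin n) → ℝ
  contDiff_tensor : ∀ i j, ContDiff ℝ ∞ (tensor i j)
  skew : ∀ i j x, tensor i j x = -tensor j i x
  jacobi : ∀ i j k x, ∑ s, (tensor i s x * partialDeriv s (tensor j k) x
    + tensor j s x * partialDeriv s (tensor k i) x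
    + tensor k s x * partialDeriv s (tensor i j) x) = 0

namespace PoissonStructure

variable {n : ℕ} (P : PoissonStructure n)

/-- The Poisson bracket `{f, g} = ∑ P_{ij} ∂_i f ∂_j g`. -/
noncomputable def bracket (f g : EuclideanSpace ℝ (Fin n) → ℝ) (x : EuclideanSpace ℝ (Fin n)) :
    ℝ :=
  ∑ i, ∑ j, P.tensor i j x * partialDeriv i f x * partialDeriv j g x

/-- The Hamiltonian vector field of `h`, with components `{x_i, h}`. -/
noncomputable def hamiltonianField (h : EuclideanSpace ℝ (Fin n) → ℝ)
    (x : EuclideanSpace ℝ (Fin n)) : EuclideanSpace ℝ (Fin n) :=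
  WithLp.toLp 2 fun i => P.bracket (fun y => y i) h x

/-- `y` is reached from `x` in unit time along a trajectory of some Hamiltonian vector field. -/
def HamiltonianStep (x y : EuclideanSpace ℝ (Fin n)) : Prop :=
  ∃ h : EuclideanSpace ℝ (Fin n) → ℝ, ContDiff ℝ ∞ h ∧
    ∃ γ : ℝ → EuclideanSpace ℝ (Fin n), γ 0 = x ∧ γ 1 = y ∧
      ∀ t ∈ Icc (0 : ℝ) 1, HasDerivWithinAt γ (P.hamiltonianField h (γ t)) (Icc 0 1) t

/-- The symplectic leaf through `x`: all points that can be joined to `x` by a curve consisting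
of finitely many pieces, each a trajectory of a Hamiltonian vector field. -/
def leaf (x : EuclideanSpace ℝ (Fin n)) : Set (EuclideanSpace ℝ (Fin n)) :=
  {y | Relation.ReflTransGen P.HamiltonianStep x y}

/-- `L` is a symplectic leaf of the Poisson structure. -/
def IsSymplecticLeaf (L : Set (EuclideanSpace ℝ (Fin n))) : Prop :=
  ∃ x, L = P.leaf x

end PoissonStructure

/-- The components `{A_i, A_j}` of the polynomial bracket of the `l : m` resonance. The
coordinates `A₁, A₂, A₃, A₄` of `ℝ⁴` are `A 0, A 1, A 2, A 3`. -/
noncomputable def resonanceTensor (l m : ℕ) (i j : Fin 4) (A : EuclideanSpace ℝ (Fin 4)) : ℝ :=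
  let X : ℝ := 1 / 2 * ((l : ℝ) ^ 2 * A 0 - (m : ℝ) ^ 2 * A 1) * A 0 ^ (m - 1) * A 1 ^ (l - 1)
  !![0,            0,            -(m * A 3),   m * A 2;
     0,            0,            l * A 3,      -(l * A 2);
     m * A 3,      -(l * A 3),   0,            -X;
     -(m * A 2),   l * A 2,      X,            0] i j

theorem contDiff_resonanceTensor (l m : ℕ) (i j : Fin 4) :
    ContDiff ℝ ∞ (resonanceTensor l m i j) := by
  unfold resonanceTensor
  fin_cases i <;> fin_cases j <;> simp <;> fun_prop

theorem partialDeriv_eq_zero_of_const {n : ℕ} (j : Fin n) (f : EuclideanSpace ℝ (Fin n) → ℝ)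
    (hf : ContDiff ℝ ∞ f) (x : EuclideanSpace ℝ (Fin n))
    (h : ∀ t : ℝ, f (x + t • EuclideanSpace.single j 1) = f x) : partialDeriv j f x = 0 := by
  have h1 := ((hf.differentiable (by simp)) x).lineDeriv_eq_fderiv
    (v := EuclideanSpace.single j (1 : ℝ))
  rw [partialDeriv, ← h1, lineDeriv]
  simp [h]

theorem partialDeriv_proj {n : ℕ} (i j : Fin n) (c : ℝ) (x : EuclideanSpace ℝ (Fin n)) :
    partialDeriv j (fun y => c * y i) x = if i = j then c else 0 := by
  have : HasFDerivAt (fun y : EuclideanSpace ℝ (Fin n) => c * y i)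
      (c • (EuclideanSpace.proj i : EuclideanSpace ℝ (Fin n) →L[ℝ] ℝ)) x :=
    (EuclideanSpace.proj (𝕜 := ℝ) i).hasFDerivAt.const_mul c
  rw [partialDeriv, this.fderiv]
  simp

/-- The Poisson structure on `ℝ⁴` of the `l : m` resonance. -/
noncomputable def resonancePoisson (l m : ℕ) : PoissonStructure 4 where
  tensor := resonanceTensor l m
  contDiff_tensor := contDiff_resonanceTensor l m
  skew i j x := by
    fin_cases i <;> fin_cases j <;> simp [resonanceTensor]
  jacobi i j k x := by
    have z (a : Fin 4) : partialDeriv a (fun _ : EuclideanSpace ℝ (Fin 4) => (0 : ℝ)) x = 0 := by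
      simp [partialDeriv]
    have e (f : EuclideanSpace ℝ (Fin 4) → ℝ) (a : Fin 4) :
        partialDeriv a (fun y => -f y) x = -partialDeriv a f x := by
      simp [partialDeriv, fderiv_fun_neg]
    have d (s : Fin 4) (hs : s = 2 ∨ s = 3) : partialDeriv s (resonanceTensor l m 3 2) x = 0 := by
      apply partialDeriv_eq_zero_of_const _ _ (contDiff_resonanceTensor l m 3 2)
      intro t
      rcases hs with rfl | rfl <;> simp [resonanceTensor]
    have d1 := d 2 (by simp)
    have d2 := d 3 (by simp)
    clear d
    unfold resonanceTensor at d1 d2 ⊢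
    simp at d1 d2
    fin_cases i <;> fin_cases j <;> fin_cases k <;>
      simp [Fin.sum_univ_four, z, e, partialDeriv_proj, d1, d2] <;> ring

theorem resonancePoisson_bracket_coord (l m : ℕ) (i j : Fin 4) (A : EuclideanSpace ℝ (Fin 4)) :
    (resonancePoisson l m).bracket (fun y => y i) (fun y => y j) A = resonanceTensor l m i j A := by
  have h (a b : Fin 4) : partialDeriv a (fun y : EuclideanSpace ℝ (Fin 4) => y b) A
      = if b = a then 1 else 0 := by
    simpa using partialDeriv_proj b a 1 A
  simp [PoissonStructure.bracket, h, resonancePoisson]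

/-- The defining relations of the bracket. -/
theorem resonancePoisson_relations (l m : ℕ) (A : EuclideanSpace ℝ (Fin 4)) :
    let br := fun i j : Fin 4 => (resonancePoisson l m).bracket (fun y => y i) (fun y => y j) A
    br 0 1 = 0 ∧ br 0 2 = -m * A 3 ∧ br 0 3 = m * A 2 ∧ br 1 2 = l * A 3 ∧ br 1 3 = -l * A 2 ∧
      br 3 2 = 1 / 2 * ((l : ℝ) ^ 2 * A 0 - (m : ℝ) ^ 2 * A 1) * A 0 ^ (m - 1) * A 1 ^ (l - 1) := by
  simp [resonancePoisson_bracket_coord, resonanceTensor]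

instance fact_finrank_euclideanSpace_three :
    Fact (Module.finrank ℝ (EuclideanSpace ℝ (Fin 3)) = 2 + 1) :=
  ⟨by simp⟩

/-- The surface `Ω = {lA₁ + mA₂ = E, A₃² + A₄² = A₁^m A₂^l}` in the region `A₁, A₂ ≥ 0`. -/
def resonanceSurface (l m : ℕ) (E : ℝ) : Set (EuclideanSpace ℝ (Fin 4)) :=
  {A | 0 ≤ A 0 ∧ 0 ≤ A 1 ∧ l * A 0 + m * A 1 = E ∧ A 2 ^ 2 + A 3 ^ 2 = A 0 ^ m * A 1 ^ l}

/-!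
The leaf whose closure is `Ω` is the regular part of `Ω`: the pole `A₁ = 0` is omitted when `m > 1`,
the pole `A₂ = 0` when `l > 1`.

Trajectories stay in the regular part (`mem_resonanceRegularPart_of_step`). Along them the Casimir
functions `lA₁ + mA₂` and `A₃² + A₄² - A₁^m A₂^l` are constant, and at an omitted pole the Poisson
tensor vanishes, so that pole is an equilibrium and by uniqueness for ODEs no trajectory from
elsewhere reaches it. A trajectory that left the region `A₁, A₂ ≥ 0` inside the level set would have
to pass through a pole, and at a pole that is not omitted the equation
`A₃² + A₄² = A₁^m A₂^l ≥ 0` has no solutions with the wrong sign nearby.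

Conversely the regular points are joined to one another (`resonance_joined`) by explicit
trajectories: the flow of a multiple of `A₁` rotates the circles of latitude
(`resonance_step_rotation`), and a Hamiltonian `A₄ k` moves along the meridian
`A₁ = (E/l) sin² θ`, `A₂ = (E/m) cos² θ`, `A₄ = 0` (`resonance_step_meridian`). As steps are
reversible, the regular part is a single leaf. At most two points of `Ω` are outside it, so no other
leaf is dense in `Ω`.

For the smooth structure, each circle of latitude of the unit sphere is scaled to the radius it has
in `Ω`. The scaling factor at height `z` is the square root of a multiple of
`(1 + z)^(m-1) (1 - z)^(l-1)`, which is continuous everywhere, positive exactly at the regular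
points, and smooth there. The resulting homeomorphism carries the smooth structure of the sphere
over to `Ω`, and the inclusion is an immersion wherever the factor is positive
(`exists_resonance_smooth_structure`).
-/

/-! ### Transport of a smooth structure along a homeomorphism -/

section Transport

variable {𝕜 V H M N : Type*} [NontriviallyNormedField 𝕜] [NormedAddCommGroup V] [NormedSpace 𝕜 V]
  [TopologicalSpace H] [TopologicalSpace M] [TopologicalSpace N] [ChartedSpace H N]

/-- The charted space structure on `M` pulled back along a homeomorphism `e : M ≃ₜ N`: its charts
are the compositions of `e` with the charts of `N`. -/
abbrev Homeomorph.pullbackChartedSpace (e : M ≃ₜ N) : ChartedSpace H M where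
  atlas := e.transOpenPartialHomeomorph '' atlas H N
  chartAt x := e.transOpenPartialHomeomorph (chartAt H (e x))
  mem_chart_source x := mem_chart_source H (e x)
  chart_mem_atlas x := mem_image_of_mem _ (chart_mem_atlas H (e x))

variable (I : ModelWithCorners 𝕜 V H) (n : ℕ∞ω) [IsManifold I n N]

theorem Homeomorph.isManifold_pullbackChartedSpace (e : M ≃ₜ N) :
    letI : ChartedSpace H M := e.pullbackChartedSpace
    IsManifold I n M := by
  let : ChartedSpace H M := e.pullbackChartedSpace
  have : HasGroupoid M (contDiffGroupoid n I) := by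
    constructor
    rintro _ _ ⟨c, hc, rfl⟩ ⟨c', hc', rfl⟩
    have h : (e.transOpenPartialHomeomorph c).symm.trans (e.transOpenPartialHomeomorph c')
        = c.symm.trans c' := by
      ext x <;> simp
    rw [h]
    exact HasGroupoid.compatible hc hc'
  exact ⟨⟩

/-- A homeomorphism is a diffeomorphism for the structure pulled back along it: in charts it is a
change of coordinates of the target. -/
def Homeomorph.pullbackDiffeomorph (e : M ≃ₜ N) :
    letI : ChartedSpace H M := e.pullbackChartedSpace
    Diffeomorph I I M N n :=
  letI : ChartedSpace H M := e.pullbackChartedSpace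
  haveI := e.isManifold_pullbackChartedSpace I n
  have hc (x : M) : chartAt H x = e.transOpenPartialHomeomorph (chartAt H (e x)) := rfl
  { toEquiv := e.toEquiv
    contMDiff_toFun := by
      refine contMDiff_iff.2 ⟨e.continuous, fun x y => ?_⟩
      refine ((contMDiff_iff.1 (contMDiff_id (I := I) (n := n) (M := N))).2 (e x) y).congr_mono
        ?_ ?_
      · intro z _
        simp [extChartAt, hc]
      · intro z hz
        simpa [extChartAt, hc] using hz
    contMDiff_invFun := by
      refine contMDiff_iff.2 ⟨e.symm.continuous, fun y x => ?_⟩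
      refine ((contMDiff_iff.1 (contMDiff_id (I := I) (n := n) (M := N))).2 y (e x)).congr_mono
        ?_ ?_
      · intro z _
        simp [extChartAt, hc]
      · intro z hz
        simpa [extChartAt, hc] using hz }

end Transport

/-! ### Hamiltonian fields and trajectories -/

theorem hasDerivWithinAt_euclideanSpace {n : ℕ} {γ : ℝ → EuclideanSpace ℝ (Fin n)}
    {v : EuclideanSpace ℝ (Fin n)} {s : Set ℝ} {t : ℝ} :
    HasDerivWithinAt γ v s t ↔ ∀ i, HasDerivWithinAt (fun r => γ r i) (v i) s t := by
  simp only [hasDerivWithinAt_iff_hasFDerivWithinAt]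
  rw [hasFDerivWithinAt_euclidean]
  refine forall_congr' fun i => ?_
  have : (PiLp.proj 2 (fun _ : Fin n => ℝ) i : EuclideanSpace ℝ (Fin n) →L[ℝ] ℝ) ∘L
      ContinuousLinearMap.toSpanSingleton ℝ v = ContinuousLinearMap.toSpanSingleton ℝ (v i) := by
    ext; simp
  rw [← this]

theorem contDiff_partialDeriv {n : ℕ} (j : Fin n) {f : EuclideanSpace ℝ (Fin n) → ℝ}
    (hf : ContDiff ℝ ∞ f) : ContDiff ℝ ∞ (partialDeriv j f) := by
  unfold partialDeriv
  exact (hf.fderiv_right (by simp)).clm_apply contDiff_const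

theorem partialDeriv_coord {n : ℕ} (i j : Fin n) (x : EuclideanSpace ℝ (Fin n)) :
    partialDeriv j (fun y => y i) x = if i = j then 1 else 0 := by
  simpa using partialDeriv_proj i j 1 x

namespace PoissonStructure

variable {n : ℕ} (P : PoissonStructure n)

theorem hamiltonianField_apply (h : EuclideanSpace ℝ (Fin n) → ℝ) (x : EuclideanSpace ℝ (Fin n))
    (i : Fin n) : P.hamiltonianField h x i = ∑ j, P.tensor i j x * partialDeriv j h x := by
  simp [hamiltonianField, bracket, partialDeriv_coord]

theorem contDiff_hamiltonianField {h : EuclideanSpace ℝ (Fin n) → ℝ} (hh : ContDiff ℝ ∞ h) :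
    ContDiff ℝ ∞ (P.hamiltonianField h) := by
  rw [contDiff_euclidean]
  intro i
  simp only [hamiltonianField_apply]
  exact ContDiff.sum fun j _ => (P.contDiff_tensor i j).mul (contDiff_partialDeriv j hh)

theorem hamiltonianField_neg (h : EuclideanSpace ℝ (Fin n) → ℝ) (x : EuclideanSpace ℝ (Fin n)) :
    P.hamiltonianField (fun y => -h y) x = -P.hamiltonianField h x := by
  ext i
  simp [hamiltonianField_apply, partialDeriv, fderiv_fun_neg]

variable {P}

theorem HamiltonianStep.symm {x y : EuclideanSpace ℝ (Fin n)} (hxy : P.HamiltonianStep x y) :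
    P.HamiltonianStep y x := by
  obtain ⟨h, hh, γ, h0, h1, hγ⟩ := hxy
  refine ⟨fun z => -h z, hh.neg, fun t => γ (1 - t), by simpa, by simpa, fun t ht => ?_⟩
  have hm : MapsTo (fun t : ℝ => 1 - t) (Icc 0 1) (Icc 0 1) := fun s hs =>
    ⟨by linarith [hs.2], by linarith [hs.1]⟩
  have hd : HasDerivWithinAt (fun t : ℝ => 1 - t) (-1) (Icc 0 1) t :=
    ((hasDerivAt_id t).const_sub 1).hasDerivWithinAt
  have := HasDerivWithinAt.scomp t (hγ (1 - t) (hm ht)) hd hm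
  rw [hamiltonianField_neg]
  simpa [Function.comp_def] using this

theorem reflTransGen_symm {x y : EuclideanSpace ℝ (Fin n)}
    (h : Relation.ReflTransGen P.HamiltonianStep x y) :
    Relation.ReflTransGen P.HamiltonianStep y x := by
  induction h with
  | refl => exact .refl
  | tail _ h ih => exact .head h.symm ih

/-- A set that Hamiltonian trajectories do not leave contains the leaves of its points. -/
theorem leaf_subset_of_step {S : Set (EuclideanSpace ℝ (Fin n))}
    (hS : ∀ x ∈ S, ∀ y, P.HamiltonianStep x y → y ∈ S) {x : EuclideanSpace ℝ (Fin n)}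
    (hx : x ∈ S) : P.leaf x ⊆ S := by
  intro y hy
  induction hy with
  | refl => exact hx
  | tail _ h ih => exact hS _ ih _ h

/-- A trajectory through a zero of the vector field has stayed there: this is uniqueness for the
initial value problem, run backwards in time. -/
theorem eq_of_hamiltonianField_eq_zero {h : EuclideanSpace ℝ (Fin n) → ℝ} (hh : ContDiff ℝ ∞ h)
    {γ : ℝ → EuclideanSpace ℝ (Fin n)}
    (hγ : ∀ t ∈ Icc (0 : ℝ) 1, HasDerivWithinAt γ (P.hamiltonianField h (γ t)) (Icc 0 1) t)
    {τ : ℝ} (hτ : τ ∈ Icc (0 : ℝ) 1) (h0 : P.hamiltonianField h (γ τ) = 0) : γ 0 = γ τ := by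
  have hc : ContinuousOn γ (Icc 0 1) := fun t ht => (hγ t ht).continuousWithinAt
  obtain ⟨R, hR⟩ := (isCompact_Icc.image_of_continuousOn hc).isBounded.subset_closedBall 0
  obtain ⟨K, hK⟩ := (P.contDiff_hamiltonianField hh).contDiffOn.exists_lipschitzOnWith
    (by simp) (convex_closedBall (0 : EuclideanSpace ℝ (Fin n)) R) (isCompact_closedBall 0 R)
  have hsub : Icc 0 τ ⊆ Icc (0 : ℝ) 1 := Icc_subset_Icc_right hτ.2
  have hb : ∀ t ∈ Icc (0 : ℝ) 1, γ t ∈ closedBall 0 R := fun t ht => hR (mem_image_of_mem _ ht)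
  refine ODE_solution_unique_of_mem_Icc_left (v := fun _ => P.hamiltonianField h)
    (s := fun _ => closedBall 0 R) (a := 0) (b := τ) (g := fun _ => γ τ) (fun _ _ => hK)
    (hc.mono hsub) (fun t ht => ?_) (fun t ht => hb t (hsub ⟨ht.1.le, ht.2⟩)) continuousOn_const
    (fun t _ => ?_) (fun _ _ => hb τ hτ) rfl (left_mem_Icc.2 hτ.1)
  · have ht' : t ∈ Icc (0 : ℝ) 1 := hsub ⟨ht.1.le, ht.2⟩
    refine (hγ t ht').mono_of_mem_nhdsWithin ?_
    exact Filter.mem_of_superset (Icc_mem_nhdsLE ht.1) (Icc_subset_Icc_right ht'.2)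
  · simpa only [h0] using hasDerivWithinAt_const t (Iic t) (γ τ)

end PoissonStructure

/-! ### The regular part of the surface -/

/-- The surface `Ω` without its singular points: the pole `A₁ = 0` is one unless `m = 1`, the pole
`A₂ = 0` is one unless `l = 1`. -/
def resonanceRegularPart (l m : ℕ) (E : ℝ) : Set (EuclideanSpace ℝ (Fin 4)) :=
  {A | A ∈ resonanceSurface l m E ∧ (m = 1 ∨ A 0 ≠ 0) ∧ (l = 1 ∨ A 1 ≠ 0)}

section

variable {l m : ℕ} {E : ℝ}

theorem resonanceField_zero (h : EuclideanSpace ℝ (Fin 4) → ℝ) (A : EuclideanSpace ℝ (Fin 4)) :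
    (resonancePoisson l m).hamiltonianField h A 0
      = -(m * A 3) * partialDeriv 2 h A + m * A 2 * partialDeriv 3 h A := by
  simp [PoissonStructure.hamiltonianField_apply, Fin.sum_univ_four, resonancePoisson,
    resonanceTensor]

theorem resonanceField_one (h : EuclideanSpace ℝ (Fin 4) → ℝ) (A : EuclideanSpace ℝ (Fin 4)) :
    (resonancePoisson l m).hamiltonianField h A 1
      = l * A 3 * partialDeriv 2 h A - l * A 2 * partialDeriv 3 h A := by
  simp [PoissonStructure.hamiltonianField_apply, Fin.sum_univ_four, resonancePoisson,
    resonanceTensor, sub_eq_add_neg]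

theorem resonanceField_two (h : EuclideanSpace ℝ (Fin 4) → ℝ) (A : EuclideanSpace ℝ (Fin 4)) :
    (resonancePoisson l m).hamiltonianField h A 2
      = m * A 3 * partialDeriv 0 h A - l * A 3 * partialDeriv 1 h A
        - 1 / 2 * ((l : ℝ) ^ 2 * A 0 - (m : ℝ) ^ 2 * A 1) * A 0 ^ (m - 1) * A 1 ^ (l - 1)
          * partialDeriv 3 h A := by
  simp [PoissonStructure.hamiltonianField_apply, Fin.sum_univ_four, resonancePoisson,
    resonanceTensor, sub_eq_add_neg]

theorem resonanceField_three (h : EuclideanSpace ℝ (Fin 4) → ℝ) (A : EuclideanSpace ℝ (Fin 4)) :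
    (resonancePoisson l m).hamiltonianField h A 3
      = -(m * A 2) * partialDeriv 0 h A + l * A 2 * partialDeriv 1 h A
        + 1 / 2 * ((l : ℝ) ^ 2 * A 0 - (m : ℝ) ^ 2 * A 1) * A 0 ^ (m - 1) * A 1 ^ (l - 1)
          * partialDeriv 2 h A := by
  simp [PoissonStructure.hamiltonianField_apply, Fin.sum_univ_four, resonancePoisson,
    resonanceTensor]

/-- The Casimir functions `lA₁ + mA₂` and `A₃² + A₄² - A₁^m A₂^l` are constant on trajectories. -/
theorem resonance_casimir (hl : 1 ≤ l) (hm : 1 ≤ m) {h : EuclideanSpace ℝ (Fin 4) → ℝ}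
    {γ : ℝ → EuclideanSpace ℝ (Fin 4)}
    (hγ : ∀ t ∈ Icc (0 : ℝ) 1,
      HasDerivWithinAt γ ((resonancePoisson l m).hamiltonianField h (γ t)) (Icc 0 1) t)
    {t : ℝ} (ht : t ∈ Icc (0 : ℝ) 1) :
    l * γ t 0 + m * γ t 1 = l * γ 0 0 + m * γ 0 1 ∧
      γ t 2 ^ 2 + γ t 3 ^ 2 - γ t 0 ^ m * γ t 1 ^ l
        = γ 0 2 ^ 2 + γ 0 3 ^ 2 - γ 0 0 ^ m * γ 0 1 ^ l := by
  have hγ' : ∀ s ∈ Icc (0 : ℝ) 1, ∀ i, HasDerivWithinAt (fun r => γ r i)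
      ((resonancePoisson l m).hamiltonianField h (γ s) i) (Icc 0 1) s := fun s hs =>
    hasDerivWithinAt_euclideanSpace.1 (hγ s hs)
  have key : ∀ f : ℝ → ℝ, (∀ s ∈ Icc (0 : ℝ) 1, HasDerivWithinAt f 0 (Icc 0 1) s) →
      f t = f 0 := fun f hf =>
    constant_of_has_deriv_right_zero (fun s hs => (hf s hs).continuousWithinAt)
      (fun s hs => (hf s ⟨hs.1, hs.2.le⟩).mono_of_mem_nhdsWithin
        (Filter.mem_of_superset (Icc_mem_nhdsGE hs.2) (Icc_subset_Icc_left hs.1))) t ht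
  constructor
  · refine key (fun s => l * γ s 0 + m * γ s 1) fun s hs => ?_
    refine (((hγ' s hs 0).const_mul (l : ℝ)).fun_add
      ((hγ' s hs 1).const_mul (m : ℝ))).congr_deriv ?_
    rw [resonanceField_zero, resonanceField_one]
    ring
  · refine key (fun s => γ s 2 ^ 2 + γ s 3 ^ 2 - γ s 0 ^ m * γ s 1 ^ l) fun s hs => ?_
    refine ((((hγ' s hs 2).fun_pow 2).fun_add ((hγ' s hs 3).fun_pow 2)).fun_sub
      (((hγ' s hs 0).fun_pow m).fun_mul ((hγ' s hs 1).fun_pow l))).congr_deriv ?_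
    rw [resonanceField_zero, resonanceField_one, resonanceField_two, resonanceField_three]
    obtain ⟨l, rfl⟩ := Nat.exists_eq_add_of_le' hl
    obtain ⟨m, rfl⟩ := Nat.exists_eq_add_of_le' hm
    simp only [Nat.add_sub_cancel]
    push_cast
    ring

/-- Trajectories do not leave the regular part. The Casimir functions confine them to the level set
that contains `Ω`, the singular points are equilibria, and what remains of `Ω` is open and closed in
what remains of the level set. -/
theorem mem_resonanceRegularPart_of_step (hl : 1 ≤ l) (hm : 1 ≤ m) (hE : 0 < E)
    (x : EuclideanSpace ℝ (Fin 4)) (hx : x ∈ resonanceRegularPart l m E)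
    (y : EuclideanSpace ℝ (Fin 4)) (hxy : (resonancePoisson l m).HamiltonianStep x y) :
    y ∈ resonanceRegularPart l m E := by
  obtain ⟨h, hh, γ, rfl, rfl, hγ⟩ := hxy
  obtain ⟨⟨hx0, hx1, hx2, hx3⟩, hxm, hxl⟩ := hx
  have hl0 : (0 : ℝ) < l := by exact_mod_cast hl
  have hm0 : (0 : ℝ) < m := by exact_mod_cast hm
  have hC1 : ∀ t ∈ Icc (0 : ℝ) 1, l * γ t 0 + m * γ t 1 = E := fun t ht =>
    (resonance_casimir hl hm hγ ht).1.trans hx2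
  have hC2 : ∀ t ∈ Icc (0 : ℝ) 1, γ t 2 ^ 2 + γ t 3 ^ 2 = γ t 0 ^ m * γ t 1 ^ l := fun t ht => by
    linarith [(resonance_casimir hl hm hγ ht).2]
  -- the Poisson tensor vanishes at `γ t`, so the whole trajectory rests there
  have hrest : ∀ t ∈ Icc (0 : ℝ) 1, γ t 0 ^ m * γ t 1 ^ l = 0 →
      γ t 0 ^ (m - 1) * γ t 1 ^ (l - 1) = 0 → γ 0 = γ t := by
    intro t ht h1 h2
    have h3 := hC2 t ht
    have h4 : γ t 2 = 0 := by nlinarith [sq_nonneg (γ t 2), sq_nonneg (γ t 3)]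
    have h5 : γ t 3 = 0 := by nlinarith [sq_nonneg (γ t 2), sq_nonneg (γ t 3)]
    refine PoissonStructure.eq_of_hamiltonianField_eq_zero hh hγ ht ?_
    ext i
    fin_cases i
    · simp [resonanceField_zero, h4, h5]
    · simp [resonanceField_one, h4, h5]
    · simp [resonanceField_two, h5, mul_assoc (_ * _) (_ ^ _) (_ ^ _), h2]
    · simp [resonanceField_three, h4, mul_assoc (_ * _) (_ ^ _) (_ ^ _), h2]
  have hreg0 : ∀ t ∈ Icc (0 : ℝ) 1, m = 1 ∨ γ t 0 ≠ 0 := by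
    intro t ht
    by_contra! hc
    have := hrest t ht (by simp [hc.2, show m ≠ 0 by lia])
      (by simp [hc.2, show m - 1 ≠ 0 by lia])
    rw [this] at hxm
    tauto
  have hreg1 : ∀ t ∈ Icc (0 : ℝ) 1, l = 1 ∨ γ t 1 ≠ 0 := by
    intro t ht
    by_contra! hc
    have := hrest t ht (by simp [hc.2, show l ≠ 0 by lia])
      (by simp [hc.2, show l - 1 ≠ 0 by lia])
    rw [this] at hxl
    tauto
  have hcont : ∀ i, ContinuousOn (fun t => γ t i) (Icc 0 1) := fun i t ht =>
    (hasDerivWithinAt_euclideanSpace.1 (hγ t ht) i).continuousWithinAt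
  have h1mem : (1 : ℝ) ∈ Icc (0 : ℝ) 1 := by simp
  have hE1 := hC1 1 h1mem
  refine ⟨⟨?_, ?_, hE1, hC2 1 h1mem⟩, hreg0 1 h1mem, hreg1 1 h1mem⟩
  · by_contra! hneg
    obtain ⟨s, hs, hs0⟩ := intermediate_value_Icc' zero_le_one (hcont 0) ⟨hneg.le, hx0⟩
    have hm1 : m = 1 := (hreg0 s hs).resolve_right (not_not.2 hs0)
    have hpos : 0 < γ 1 1 := by nlinarith
    have := hC2 1 h1mem
    rw [hm1, pow_one] at this
    nlinarith [sq_nonneg (γ 1 2), sq_nonneg (γ 1 3), mul_neg_of_neg_of_pos hneg (pow_pos hpos l)]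
  · by_contra! hneg
    obtain ⟨s, hs, hs0⟩ := intermediate_value_Icc' zero_le_one (hcont 1) ⟨hneg.le, hx1⟩
    have hl1 : l = 1 := (hreg1 s hs).resolve_right (not_not.2 hs0)
    have hpos : 0 < γ 1 0 := by nlinarith
    have := hC2 1 h1mem
    rw [hl1, pow_one] at this
    nlinarith [sq_nonneg (γ 1 2), sq_nonneg (γ 1 3), mul_neg_of_pos_of_neg (pow_pos hpos m) hneg]

/-! ### Trajectories joining the regular points -/

/-- Points of a circle of latitude are joined by the flow of a multiple of `A₁`, a rotation. -/
theorem resonance_step_rotation (hm : 1 ≤ m) {A B : EuclideanSpace ℝ (Fin 4)} (h0 : A 0 = B 0)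
    (h1 : A 1 = B 1) (h23 : A 2 ^ 2 + A 3 ^ 2 = B 2 ^ 2 + B 3 ^ 2) :
    (resonancePoisson l m).HamiltonianStep A B := by
  have hm0 : (m : ℝ) ≠ 0 := by positivity
  obtain ⟨φ, hφ2, hφ3⟩ : ∃ φ : ℝ, B 2 = A 2 * Real.cos φ + A 3 * Real.sin φ ∧
      B 3 = -A 2 * Real.sin φ + A 3 * Real.cos φ := by
    set z : ℂ := ⟨A 2, A 3⟩
    set w : ℂ := ⟨B 2, B 3⟩
    have hzw : ‖z‖ = ‖w‖ := by
      rw [← sq_eq_sq₀ (norm_nonneg _) (norm_nonneg _), ← Complex.normSq_eq_norm_sq,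
        ← Complex.normSq_eq_norm_sq, Complex.normSq_mk, Complex.normSq_mk]
      linarith
    have hz := Complex.norm_mul_exp_arg_mul_I z
    have hw := Complex.norm_mul_exp_arg_mul_I w
    have e : w = z * Complex.exp (((-(z.arg - w.arg) : ℝ) : ℂ) * Complex.I) := by
      conv_lhs => rw [← hw, ← hzw]
      conv_rhs => rw [← hz]
      rw [mul_assoc, ← Complex.exp_add]
      congr 2
      push_cast
      rw [hz]
      ring
    refine ⟨z.arg - w.arg, ?_, ?_⟩
    · have := congrArg Complex.re e
      rw [Complex.mul_re, Complex.exp_ofReal_mul_I_re, Complex.exp_ofReal_mul_I_im, Real.cos_neg,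
        Real.sin_neg] at this
      linarith
    · have := congrArg Complex.im e
      rw [Complex.mul_im, Complex.exp_ofReal_mul_I_re, Complex.exp_ofReal_mul_I_im, Real.cos_neg,
        Real.sin_neg] at this
      linarith
  refine ⟨fun y => φ / m * y 0, by fun_prop, fun t => !₂[A 0, A 1,
    A 2 * Real.cos (φ * t) + A 3 * Real.sin (φ * t),
    -A 2 * Real.sin (φ * t) + A 3 * Real.cos (φ * t)], ?_, ?_, fun t _ => ?_⟩
  · ext i; fin_cases i <;> simp
  · ext i; fin_cases i <;> simp [h0, h1, hφ2, hφ3]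
  · have hd : HasDerivAt (fun r : ℝ => φ * r) φ t := by
      simpa using (hasDerivAt_id t).const_mul φ
    rw [hasDerivWithinAt_euclideanSpace]
    intro i
    fin_cases i
    · simpa [resonanceField_zero, partialDeriv_proj] using hasDerivWithinAt_const t (Icc 0 1) (A 0)
    · simpa [resonanceField_one, partialDeriv_proj] using hasDerivWithinAt_const t (Icc 0 1) (A 1)
    · refine (((hd.cos.const_mul (A 2)).fun_add
        (hd.sin.const_mul (A 3))).congr_deriv ?_).hasDerivWithinAt
      simp [resonanceField_two, partialDeriv_proj]
      field_simp
    · refine (((hd.sin.const_mul (-A 2)).fun_add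
        (hd.cos.const_mul (A 3))).congr_deriv ?_).hasDerivWithinAt
      simp [resonanceField_three, partialDeriv_proj]
      field_simp
      ring

/-- The meridian of `Ω` in the half-space `A₄ = 0`, `A₃ ≥ 0`, from the pole `A₁ = 0` at `θ = 0` to
the pole `A₂ = 0` at `θ = π / 2`. -/
noncomputable def resonanceMeridian (l m : ℕ) (E θ : ℝ) : EuclideanSpace ℝ (Fin 4) :=
  !₂[E / l * Real.sin θ ^ 2, E / m * Real.cos θ ^ 2,
    √((E / l) ^ m * (E / m) ^ l) * Real.sin θ ^ m * Real.cos θ ^ l, 0]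

/-- Away from `0`, inverse powers of the square root have smooth extensions to the line. -/
theorem exists_contDiff_mul_pow_eq_one (k : ℕ) {δ : ℝ} (hk : k = 1 ∨ 0 < δ) :
    ∃ W : ℝ → ℝ, ContDiff ℝ ∞ W ∧ ∀ s, δ ≤ s → W (s ^ 2) * s ^ (k - 1) = 1 := by
  rcases hk with rfl | hδ
  · exact ⟨fun _ => 1, contDiff_const, by simp⟩
  -- `u` is positive everywhere and equals the identity on `[δ², ∞)`
  let u : ℝ → ℝ := fun y => 1 + (y - 1) * Real.smoothTransition (y / δ ^ 2)
  have hu : ContDiff ℝ ∞ u :=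
    contDiff_const.add ((contDiff_id.sub contDiff_const).mul
      (Real.smoothTransition.contDiff.comp (contDiff_id.div_const _)))
  have hpos : ∀ y, 0 < u y := by
    intro y
    have h1 := Real.smoothTransition.le_one (y / δ ^ 2)
    have h0 := Real.smoothTransition.nonneg (y / δ ^ 2)
    rcases le_or_gt y 0 with hy | hy
    · have h2 := Real.smoothTransition.zero_of_nonpos
        (div_nonpos_of_nonpos_of_nonneg hy (sq_nonneg δ))
      simp only [u, h2]
      norm_num
    · have h2 := Real.smoothTransition.pos_of_pos (x := y / δ ^ 2) (by positivity)
      simp only [u]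
      nlinarith [mul_pos hy h2]
  refine ⟨fun y => ((√(u y))⁻¹) ^ (k - 1),
    ((hu.sqrt fun y => (hpos y).ne').inv fun y => (Real.sqrt_pos.2 (hpos y)).ne').pow _, ?_⟩
  intro s hs
  have hs0 : 0 < s := hδ.trans_le hs
  have hone : Real.smoothTransition (s ^ 2 / δ ^ 2) = 1 :=
    Real.smoothTransition.one_of_one_le ((one_le_div (by positivity)).2 (by gcongr))
  have : √(u (s ^ 2)) = s := by
    simp only [u, hone, mul_one, add_sub_cancel]
    exact Real.sqrt_sq hs0.le
  simp only [this]
  rw [← mul_pow, inv_mul_cancel₀ hs0.ne', one_pow]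

theorem partialDeriv_coord_mul {n : ℕ} (i j : Fin n) {k : EuclideanSpace ℝ (Fin n) → ℝ}
    (hk : ContDiff ℝ ∞ k) {x : EuclideanSpace ℝ (Fin n)} (hx : x i = 0) :
    partialDeriv j (fun y => y i * k y) x = if i = j then k x else 0 := by
  have h1 : HasFDerivAt (fun y : EuclideanSpace ℝ (Fin n) => y i)
      (EuclideanSpace.proj i : EuclideanSpace ℝ (Fin n) →L[ℝ] ℝ) x :=
    (EuclideanSpace.proj (𝕜 := ℝ) i).hasFDerivAt
  have h2 := h1.fun_mul (hk.differentiable (by simp) x).hasFDerivAt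
  rw [partialDeriv, h2.fderiv]
  simp [hx]

theorem sq_sqrt_resonance (hE : 0 < E) :
    √((E / l) ^ m * (E / m) ^ l) ^ 2 = (E / l) ^ m * (E / m) ^ l :=
  Real.sq_sqrt (by positivity)

/-- Arcs of the meridian are trajectories. On `A₄ = 0` the field of `A₄ k` is `k` times that of
`A₄`, which is tangent to the meridian, so `k` can be chosen to give the uniform motion in `θ`; the
factors of `k` that blow up at singular points are replaced by smooth ones away from the arc. -/
theorem resonance_step_meridian (hl : 1 ≤ l) (hm : 1 ≤ m) (hE : 0 < E) {α β : ℝ}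
    (hα : 0 ≤ α) (hαβ : α ≤ β) (hβ : β ≤ Real.pi / 2) (hαm : m = 1 ∨ 0 < Real.sin α)
    (hβl : l = 1 ∨ 0 < Real.cos β) :
    (resonancePoisson l m).HamiltonianStep (resonanceMeridian l m E α)
      (resonanceMeridian l m E β) := by
  have hl0 : (l : ℝ) ≠ 0 := by positivity
  have hm0 : (m : ℝ) ≠ 0 := by positivity
  obtain ⟨U, hU, hU1⟩ := exists_contDiff_mul_pow_eq_one m hαm
  obtain ⟨W, hW, hW1⟩ := exists_contDiff_mul_pow_eq_one l hβl
  have hc2 := sq_sqrt_resonance (l := l) (m := m) hE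
  have hc0 : 0 < √((E / l) ^ m * (E / m) ^ l) := Real.sqrt_pos.2 (by positivity)
  set c := √((E / l) ^ m * (E / m) ^ l) with hc
  -- the factor that turns the field of `A₄` into the velocity `β - α` in `θ`: the inverse powers of
  -- `sin θ` and `cos θ` it requires are `U` and `W` at `sin² θ = l A₁ / E` and `cos² θ = m A₂ / E`
  let k : EuclideanSpace ℝ (Fin 4) → ℝ := fun y =>
    (β - α) * (2 * E / (l * m * c)) * U (l / E * y 0) * W (m / E * y 1)
  have hk : ContDiff ℝ ∞ k := by
    refine (contDiff_const.mul (hU.comp ?_)).mul (hW.comp ?_) <;> fun_prop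
  refine ⟨fun y => y 3 * k y, ContDiff.mul (by fun_prop) hk,
    fun t => resonanceMeridian l m E (α + t * (β - α)), by simp, by simp, fun t ht => ?_⟩
  set θ := α + t * (β - α) with hθ
  have hαθ : α ≤ θ := by nlinarith [ht.1]
  have hθβ : θ ≤ β := by nlinarith [ht.2]
  have hUθ := hU1 (Real.sin θ)
    (Real.sin_le_sin_of_le_of_le_pi_div_two (by linarith [Real.pi_pos]) (by linarith) hαθ)
  have hWθ := hW1 (Real.cos θ)
    (Real.cos_le_cos_of_nonneg_of_le_pi (by linarith) (by linarith [Real.pi_pos]) hθβ)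
  have hkθ : k (resonanceMeridian l m E θ)
      = (β - α) * (2 * E / (l * m * c)) * U (Real.sin θ ^ 2) * W (Real.cos θ ^ 2) := by
    have h1 : l / E * (E / l * Real.sin θ ^ 2) = Real.sin θ ^ 2 := by field_simp
    have h2 : m / E * (E / m * Real.cos θ ^ 2) = Real.cos θ ^ 2 := by field_simp
    simp [k, resonanceMeridian, h1, h2]
  have hp (j : Fin 4) := partialDeriv_coord_mul 3 j hk
    (x := resonanceMeridian l m E θ) (by simp [resonanceMeridian])
  have hd : HasDerivAt (fun r : ℝ => α + r * (β - α)) (β - α) t := by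
    simpa using ((hasDerivAt_id t).mul_const (β - α)).const_add α
  have hs := hd.sin
  have hcs := hd.cos
  simp only [← hθ] at hs hcs
  have f0 : (resonancePoisson l m).hamiltonianField (fun y => y 3 * k y)
      (resonanceMeridian l m E θ) 0 = m * (c * Real.sin θ ^ m * Real.cos θ ^ l)
        * k (resonanceMeridian l m E θ) := by
    rw [resonanceField_zero, hp, hp]
    simp [resonanceMeridian, hc]
  have f1 : (resonancePoisson l m).hamiltonianField (fun y => y 3 * k y)
      (resonanceMeridian l m E θ) 1 = -(l * (c * Real.sin θ ^ m * Real.cos θ ^ l)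
        * k (resonanceMeridian l m E θ)) := by
    rw [resonanceField_one, hp, hp]
    simp [resonanceMeridian, hc]
  have f2 : (resonancePoisson l m).hamiltonianField (fun y => y 3 * k y)
      (resonanceMeridian l m E θ) 2
        = -(1 / 2 * (l ^ 2 * (E / l * Real.sin θ ^ 2) - m ^ 2 * (E / m * Real.cos θ ^ 2))
          * (E / l * Real.sin θ ^ 2) ^ (m - 1) * (E / m * Real.cos θ ^ 2) ^ (l - 1)
          * k (resonanceMeridian l m E θ)) := by
    rw [resonanceField_two, hp, hp, hp]
    simp [resonanceMeridian]
  have f3 : (resonancePoisson l m).hamiltonianField (fun y => y 3 * k y)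
      (resonanceMeridian l m E θ) 3 = 0 := by
    rw [resonanceField_three, hp, hp, hp]
    simp
  rw [hkθ] at f0 f1 f2
  generalize U (Real.sin θ ^ 2) = u at *
  generalize W (Real.cos θ ^ 2) = w at *
  have hSm : Real.sin θ ^ m = Real.sin θ ^ (m - 1) * Real.sin θ := by
    rw [← pow_succ, Nat.sub_add_cancel hm]
  have hCl : Real.cos θ ^ l = Real.cos θ ^ (l - 1) * Real.cos θ := by
    rw [← pow_succ, Nat.sub_add_cancel hl]
  have hc2' : c * c = (E / l) ^ (m - 1) * (E / m) ^ (l - 1) * (E * E / (l * m)) := by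
    have e1 : (E / l) ^ m = (E / l) ^ (m - 1) * (E / l) := by rw [← pow_succ, Nat.sub_add_cancel hm]
    have e2 : (E / m) ^ l = (E / m) ^ (l - 1) * (E / m) := by rw [← pow_succ, Nat.sub_add_cancel hl]
    rw [← sq, hc2, e1, e2]
    ring
  rw [hasDerivWithinAt_euclideanSpace]
  intro i
  fin_cases i
  · refine (((hs.fun_pow 2).const_mul (E / (l : ℝ))).congr_deriv ?_).hasDerivWithinAt
    refine Eq.trans ?_ f0.symm
    simp only [← hθ]
    rw [hSm, hCl]
    trans E / l * (2 * Real.sin θ * (Real.cos θ * (β - α)))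
      * (u * Real.sin θ ^ (m - 1)) * (w * Real.cos θ ^ (l - 1))
    · rw [hUθ, hWθ]
      norm_num
    · field_simp
  · refine (((hcs.fun_pow 2).const_mul (E / (m : ℝ))).congr_deriv ?_).hasDerivWithinAt
    refine Eq.trans ?_ f1.symm
    simp only [← hθ]
    rw [hSm, hCl]
    trans -(E / m * (2 * Real.sin θ * (Real.cos θ * (β - α)))
      * (u * Real.sin θ ^ (m - 1)) * (w * Real.cos θ ^ (l - 1)))
    · rw [hUθ, hWθ]
      norm_num
      ring_nf
      simp
    · field_simp
  · refine ((((hs.fun_pow m).const_mul c).fun_mul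
      (hcs.fun_pow l)).congr_deriv ?_).hasDerivWithinAt
    refine Eq.trans ?_ f2.symm
    simp only [← hθ]
    rw [hSm, hCl]
    trans (c * c / c) * (m * Real.cos θ ^ 2 - l * Real.sin θ ^ 2) * (β - α)
      * (Real.sin θ ^ (m - 1) * Real.cos θ ^ (l - 1))
      * (u * Real.sin θ ^ (m - 1)) * (w * Real.cos θ ^ (l - 1))
    · rw [hUθ, hWθ, mul_div_cancel_right₀ _ hc0.ne']
      ring
    · rw [hc2']
      have e (a x : ℝ) (k : ℕ) : (a * x ^ 2) ^ k = a ^ k * (x ^ k * x ^ k) := by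
        rw [mul_pow, ← pow_mul, mul_comm 2, pow_mul, sq]
      rw [e, e]
      generalize Real.sin θ ^ (m - 1) = p
      generalize Real.cos θ ^ (l - 1) = q
      generalize (E / l) ^ (m - 1) = a
      generalize (E / m) ^ (l - 1) = b
      have e1 (y : ℝ) : (l : ℝ) ^ 2 * (E / l * y) = l * E * y := by field_simp
      have e2 (y : ℝ) : (m : ℝ) ^ 2 * (E / m * y) = m * E * y := by field_simp
      rw [e1, e2]
      ring
  · refine ((hasDerivAt_const t (0 : ℝ)).congr_deriv ?_).hasDerivWithinAt
    exact f3.symm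

end

/-! ### The leaf and its closure -/

section

variable {l m : ℕ} {E : ℝ}

theorem resonanceMeridian_mem (hl : 1 ≤ l) (hm : 1 ≤ m) (hE : 0 < E) (θ : ℝ) :
    resonanceMeridian l m E θ ∈ resonanceSurface l m E := by
  have hl0 : (0 : ℝ) < l := by exact_mod_cast hl
  have hm0 : (0 : ℝ) < m := by exact_mod_cast hm
  refine ⟨?_, ?_, ?_, ?_⟩ <;> simp only [resonanceMeridian, PiLp.toLp_apply, Matrix.cons_val]
  · positivity
  · positivity
  · field_simp
    linear_combination Real.sin_sq_add_cos_sq θ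
  · rw [mul_pow, mul_pow, sq_sqrt_resonance hE]
    ring

theorem continuous_resonanceMeridian : Continuous (resonanceMeridian l m E) := by
  refine (PiLp.continuous_toLp 2 _).comp (continuous_pi fun i => ?_)
  fin_cases i <;> simp <;> fun_prop

/-- Every point of the surface is a rotation of a point of the meridian. -/
theorem exists_resonanceMeridian (hl : 1 ≤ l) (hm : 1 ≤ m) (hE : 0 < E)
    {A : EuclideanSpace ℝ (Fin 4)} (hA : A ∈ resonanceSurface l m E) :
    ∃ θ ∈ Icc 0 (Real.pi / 2), A 0 = resonanceMeridian l m E θ 0 ∧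
      A 1 = resonanceMeridian l m E θ 1 := by
  obtain ⟨h0, h1, h2, -⟩ := hA
  have hl0 : (0 : ℝ) < l := by exact_mod_cast hl
  have hm0 : (0 : ℝ) < m := by exact_mod_cast hm
  have hy0 : 0 ≤ l / E * A 0 := by positivity
  have hy1 : l / E * A 0 ≤ 1 := by
    rw [div_mul_eq_mul_div, div_le_one hE]
    nlinarith
  have hs : Real.sin (Real.arcsin √(l / E * A 0)) ^ 2 = l / E * A 0 := by
    rw [Real.sin_arcsin (by linarith [Real.sqrt_nonneg (l / E * A 0)]) (Real.sqrt_le_one.2 hy1),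
      Real.sq_sqrt hy0]
  refine ⟨Real.arcsin √(l / E * A 0), ⟨Real.arcsin_nonneg.2 (Real.sqrt_nonneg _),
    Real.arcsin_le_pi_div_two _⟩, ?_, ?_⟩
  · simp only [resonanceMeridian, PiLp.toLp_apply, Matrix.cons_val, hs]
    field_simp
  · simp only [resonanceMeridian, PiLp.toLp_apply, Matrix.cons_val, Real.cos_sq', hs]
    field_simp
    linarith

theorem resonance_step_of_latitude (hm : 1 ≤ m)
    {A B : EuclideanSpace ℝ (Fin 4)} (hA : A ∈ resonanceSurface l m E)
    (hB : B ∈ resonanceSurface l m E) (h0 : A 0 = B 0) :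
    (resonancePoisson l m).HamiltonianStep A B := by
  have hm0 : (0 : ℝ) < m := by exact_mod_cast hm
  obtain ⟨-, -, hA2, hA3⟩ := hA
  obtain ⟨-, -, hB2, hB3⟩ := hB
  have h1 : A 1 = B 1 := by
    rw [h0, ← hB2] at hA2
    exact mul_left_cancel₀ hm0.ne' (add_left_cancel hA2)
  exact resonance_step_rotation hm h0 h1 (by rw [hA3, hB3, h0, h1])

theorem resonanceMeridian_pi_div_four_mem (hl : 1 ≤ l) (hm : 1 ≤ m) (hE : 0 < E) :
    resonanceMeridian l m E (Real.pi / 4) ∈ resonanceRegularPart l m E := by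
  have hl0 : (l : ℝ) ≠ 0 := by positivity
  have hm0 : (m : ℝ) ≠ 0 := by positivity
  exact ⟨resonanceMeridian_mem hl hm hE _, .inr (by simp [resonanceMeridian, hE.ne', hl0]),
    .inr (by simp [resonanceMeridian, hE.ne', hm0])⟩

/-- Regular points are joined to the middle of the meridian, first by a rotation and then along the
meridian. -/
theorem resonance_joined (hl : 1 ≤ l) (hm : 1 ≤ m) (hE : 0 < E) {A : EuclideanSpace ℝ (Fin 4)}
    (hA : A ∈ resonanceRegularPart l m E) :
    Relation.ReflTransGen (resonancePoisson l m).HamiltonianStep A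
      (resonanceMeridian l m E (Real.pi / 4)) := by
  obtain ⟨hAΩ, hAm, hAl⟩ := hA
  obtain ⟨θ, hθ, h0, h1⟩ := exists_resonanceMeridian hl hm hE hAΩ
  have hstep := resonance_step_of_latitude hm hAΩ (resonanceMeridian_mem hl hm hE θ) h0
  have hpi := Real.pi_pos
  have hsin : m = 1 ∨ 0 < Real.sin θ := by
    refine hAm.imp_right fun h => ?_
    refine (Real.sin_nonneg_of_nonneg_of_le_pi hθ.1 (by linarith [hθ.2])).lt_of_ne' fun hs => h ?_
    simp [h0, resonanceMeridian, hs]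
  have hcos : l = 1 ∨ 0 < Real.cos θ := by
    refine hAl.imp_right fun h => ?_
    refine (Real.cos_nonneg_of_neg_pi_div_two_le_of_le (by linarith [hθ.1]) hθ.2).lt_of_ne'
      fun hs => h ?_
    simp [h1, resonanceMeridian, hs]
  refine (Relation.ReflTransGen.single hstep).tail ?_
  rcases le_total θ (Real.pi / 4) with h | h
  · exact resonance_step_meridian hl hm hE hθ.1 h (by linarith) hsin (.inr (by simp))
  · exact (resonance_step_meridian hl hm hE (by linarith) h hθ.2 (.inr (by simp)) hcos).symm

theorem resonance_leaf_eq (hl : 1 ≤ l) (hm : 1 ≤ m) (hE : 0 < E) {A : EuclideanSpace ℝ (Fin 4)}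
    (hA : A ∈ resonanceRegularPart l m E) :
    (resonancePoisson l m).leaf A = resonanceRegularPart l m E :=
  Subset.antisymm
    (PoissonStructure.leaf_subset_of_step (mem_resonanceRegularPart_of_step hl hm hE) hA)
    fun _ hB => (resonance_joined hl hm hE hA).trans
      (PoissonStructure.reflTransGen_symm (resonance_joined hl hm hE hB))

theorem resonanceMeridian_zero (hm : 1 ≤ m) :
    resonanceMeridian l m E 0 = !₂[0, E / m, 0, 0] := by
  ext i
  fin_cases i <;> simp [resonanceMeridian, show m ≠ 0 by lia]

theorem resonanceMeridian_pi_div_two (hl : 1 ≤ l) :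
    resonanceMeridian l m E (Real.pi / 2) = !₂[E / l, 0, 0, 0] := by
  ext i
  fin_cases i <;> simp [resonanceMeridian, show l ≠ 0 by lia]

theorem resonanceSurface_coord_zero_eq_zero_iff (hm : 1 ≤ m)
    {A : EuclideanSpace ℝ (Fin 4)} (hA : A ∈ resonanceSurface l m E) :
    A 0 = 0 ↔ A = !₂[0, E / m, 0, 0] := by
  constructor
  · intro h
    obtain ⟨-, -, h2, h3⟩ := hA
    have hm0 : (m : ℝ) ≠ 0 := by positivity
    rw [h, zero_pow (by lia), zero_mul] at h3
    have h4 : A 2 = 0 := by nlinarith [sq_nonneg (A 2), sq_nonneg (A 3)]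
    have h5 : A 3 = 0 := by nlinarith [sq_nonneg (A 2), sq_nonneg (A 3)]
    have h6 : A 1 = E / m := by
      rw [eq_div_iff hm0]
      rw [h] at h2
      linarith
    ext i
    fin_cases i <;> simp [h, h4, h5, h6]
  · rintro rfl
    simp

theorem resonanceSurface_coord_one_eq_zero_iff (hl : 1 ≤ l)
    {A : EuclideanSpace ℝ (Fin 4)} (hA : A ∈ resonanceSurface l m E) :
    A 1 = 0 ↔ A = !₂[E / l, 0, 0, 0] := by
  constructor
  · intro h
    obtain ⟨-, -, h2, h3⟩ := hA
    have hl0 : (l : ℝ) ≠ 0 := by positivity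
    rw [h, zero_pow (by lia), mul_zero] at h3
    have h4 : A 2 = 0 := by nlinarith [sq_nonneg (A 2), sq_nonneg (A 3)]
    have h5 : A 3 = 0 := by nlinarith [sq_nonneg (A 2), sq_nonneg (A 3)]
    have h6 : A 0 = E / l := by
      rw [eq_div_iff hl0]
      rw [h] at h2
      linarith
    ext i
    fin_cases i <;> simp [h, h4, h5, h6]
  · rintro rfl
    simp

theorem resonanceSurface_diff_regularPart_subset (hl : 1 ≤ l) (hm : 1 ≤ m) :
    resonanceSurface l m E \ resonanceRegularPart l m E
      ⊆ {resonanceMeridian l m E 0, resonanceMeridian l m E (Real.pi / 2)} := by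
  rintro A ⟨hA, hA'⟩
  rw [resonanceMeridian_zero hm, resonanceMeridian_pi_div_two hl, mem_insert_iff,
    mem_singleton_iff, ← resonanceSurface_coord_zero_eq_zero_iff hm hA,
    ← resonanceSurface_coord_one_eq_zero_iff hl hA]
  by_contra! h
  exact hA' ⟨hA, .inr h.1, .inr h.2⟩

theorem isClosed_resonanceSurface : IsClosed (resonanceSurface l m E) := by
  simp only [resonanceSurface, ofPred_and]
  refine (isClosed_le ?_ ?_).inter ((isClosed_le ?_ ?_).inter ((isClosed_eq ?_ ?_).inter
    (isClosed_eq ?_ ?_))) <;> fun_prop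

theorem closure_resonanceRegularPart (hl : 1 ≤ l) (hm : 1 ≤ m) (hE : 0 < E) :
    closure (resonanceRegularPart l m E) = resonanceSurface l m E := by
  have hl0 : (l : ℝ) ≠ 0 := by positivity
  have hm0 : (m : ℝ) ≠ 0 := by positivity
  refine Subset.antisymm (closure_minimal (fun A hA => hA.1) isClosed_resonanceSurface) ?_
  have hpi := Real.pi_pos
  -- the two poles are limits along the meridian
  have hIoo : resonanceMeridian l m E '' Ioo 0 (Real.pi / 2) ⊆ resonanceRegularPart l m E := by
    rintro _ ⟨θ, hθ, rfl⟩
    have hs : Real.sin θ ≠ 0 := (Real.sin_pos_of_pos_of_lt_pi hθ.1 (by linarith [hθ.2])).ne'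
    have hc : Real.cos θ ≠ 0 := (Real.cos_pos_of_mem_Ioo ⟨by linarith [hθ.1], hθ.2⟩).ne'
    exact ⟨resonanceMeridian_mem hl hm hE θ, .inr (by simp [resonanceMeridian, hE.ne', hl0, hs]),
      .inr (by simp [resonanceMeridian, hE.ne', hm0, hc])⟩
  have hIcc : ∀ θ ∈ Icc 0 (Real.pi / 2),
      resonanceMeridian l m E θ ∈ closure (resonanceRegularPart l m E) := by
    intro θ hθ
    rw [← closure_Ioo (by positivity : (0 : ℝ) ≠ Real.pi / 2)] at hθ
    exact closure_mono hIoo (image_closure_subset_closure_image continuous_resonanceMeridian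
      (mem_image_of_mem _ hθ))
  intro A hA
  by_cases hA' : A ∈ resonanceRegularPart l m E
  · exact subset_closure hA'
  · rcases resonanceSurface_diff_regularPart_subset hl hm ⟨hA, hA'⟩ with rfl | rfl
    · exact hIcc _ ⟨le_rfl, by positivity⟩
    · exact hIcc _ ⟨by positivity, le_rfl⟩

/-- A leaf dense in the surface meets the regular part: the rest of the surface is finite. -/
theorem eq_resonanceRegularPart_of_closure_eq (hl : 1 ≤ l) (hm : 1 ≤ m) (hE : 0 < E)
    {L : Set (EuclideanSpace ℝ (Fin 4))} (hL : (resonancePoisson l m).IsSymplecticLeaf L)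
    (hc : closure L = resonanceSurface l m E) : L = resonanceRegularPart l m E := by
  obtain ⟨x, rfl⟩ := hL
  have hLΩ : (resonancePoisson l m).leaf x ⊆ resonanceSurface l m E := hc ▸ subset_closure
  by_cases hy : ∃ y ∈ (resonancePoisson l m).leaf x, y ∈ resonanceRegularPart l m E
  · obtain ⟨y, hxy, hy⟩ := hy
    have hx : x ∈ resonanceRegularPart l m E := by
      rw [← resonance_leaf_eq hl hm hE hy]
      exact PoissonStructure.reflTransGen_symm hxy
    exact resonance_leaf_eq hl hm hE hx
  · exfalso
    push Not at hy
    have hsub : resonanceSurface l m E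
        ⊆ {resonanceMeridian l m E 0, resonanceMeridian l m E (Real.pi / 2)} := by
      rw [← hc]
      exact closure_minimal (fun y h =>
        resonanceSurface_diff_regularPart_subset hl hm ⟨hLΩ h, hy y h⟩) (toFinite _).isClosed
    have hl0 : (l : ℝ) ≠ 0 := by positivity
    have hm0 : (m : ℝ) ≠ 0 := by positivity
    rcases hsub (resonanceMeridian_mem hl hm hE (Real.pi / 4)) with h | h
    · have := congrArg (fun A => A 0) h
      simp [resonanceMeridian, hE.ne', hl0] at this
    · have := congrArg (fun A => A 1) h
      simp [resonanceMeridian, hE.ne', hm0] at this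

end

/-! ### Parametrization by the sphere -/

section

variable {l m : ℕ} {E : ℝ}

/-- The ratio at height `z` of the radius of the circle of latitude of `Ω` to that of the unit
sphere. -/
noncomputable def resonanceRadius (l m : ℕ) (E z : ℝ) : ℝ :=
  √((E / (2 * l)) ^ m * (E / (2 * m)) ^ l * ((1 + z) ^ (m - 1) * (1 - z) ^ (l - 1)))

/-- The map of `ℝ³` to `ℝ⁴` that sends the unit sphere to `Ω`: it is affine on the axis of rotation
and scales each circle of latitude to the radius it has in `Ω`. -/
noncomputable def resonanceParam (l m : ℕ) (E : ℝ) (v : EuclideanSpace ℝ (Fin 3)) :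
    EuclideanSpace ℝ (Fin 4) :=
  !₂[E / (2 * l) * (1 + v 2), E / (2 * m) * (1 - v 2),
    v 0 * resonanceRadius l m E (v 2), v 1 * resonanceRadius l m E (v 2)]

theorem mem_unitSphere_iff (v : EuclideanSpace ℝ (Fin 3)) :
    v ∈ sphere (0 : EuclideanSpace ℝ (Fin 3)) 1 ↔ v 0 ^ 2 + v 1 ^ 2 = (1 + v 2) * (1 - v 2) := by
  rw [mem_sphere_zero_iff_norm, EuclideanSpace.norm_eq, Real.sqrt_eq_one, Fin.sum_univ_three]
  simp only [Real.norm_eq_abs, sq_abs]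
  constructor <;> intro h <;> linarith

theorem unitSphere_bounds {v : EuclideanSpace ℝ (Fin 3)}
    (hv : v 0 ^ 2 + v 1 ^ 2 = (1 + v 2) * (1 - v 2)) : 0 ≤ 1 + v 2 ∧ 0 ≤ 1 - v 2 := by
  constructor <;> nlinarith [sq_nonneg (v 0), sq_nonneg (v 1)]

theorem resonanceRadius_sq (hE : 0 < E) {z : ℝ} (h1 : 0 ≤ 1 + z) (h2 : 0 ≤ 1 - z) :
    resonanceRadius l m E z ^ 2
      = (E / (2 * l)) ^ m * (E / (2 * m)) ^ l * ((1 + z) ^ (m - 1) * (1 - z) ^ (l - 1)) :=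
  Real.sq_sqrt (by positivity)

theorem continuous_resonanceParam : Continuous (resonanceParam l m E) := by
  refine (PiLp.continuous_toLp 2 _).comp (continuous_pi fun i => ?_)
  fin_cases i <;> simp [resonanceRadius] <;> fun_prop

theorem resonanceParam_mem (hl : 1 ≤ l) (hm : 1 ≤ m) (hE : 0 < E) {v : EuclideanSpace ℝ (Fin 3)}
    (hv : v ∈ sphere (0 : EuclideanSpace ℝ (Fin 3)) 1) :
    resonanceParam l m E v ∈ resonanceSurface l m E := by
  have hl0 : (0 : ℝ) < l := by exact_mod_cast hl
  have hm0 : (0 : ℝ) < m := by exact_mod_cast hm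
  rw [mem_unitSphere_iff] at hv
  obtain ⟨h1, h2⟩ := unitSphere_bounds hv
  refine ⟨?_, ?_, ?_, ?_⟩ <;> simp only [resonanceParam, PiLp.toLp_apply, Matrix.cons_val]
  · positivity
  · positivity
  · field_simp
    ring
  · rw [mul_pow, mul_pow, ← add_mul, hv, resonanceRadius_sq hE h1 h2, mul_pow, mul_pow,
      ← mul_pow_sub_one (by lia : m ≠ 0) (1 + v 2), ← mul_pow_sub_one (by lia : l ≠ 0) (1 - v 2)]
    ring

theorem resonanceRadius_eq_zero (hl : 1 ≤ l) (hm : 1 ≤ m) (hE : 0 < E) {z : ℝ}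
    (h1 : 0 ≤ 1 + z) (h2 : 0 ≤ 1 - z) (h : resonanceRadius l m E z = 0) :
    (1 + z) * (1 - z) = 0 := by
  have hl0 : (l : ℝ) ≠ 0 := by positivity
  have hm0 : (m : ℝ) ≠ 0 := by positivity
  have h3 := resonanceRadius_sq (l := l) (m := m) hE h1 h2
  rw [h, zero_pow two_ne_zero] at h3
  have h4 : (1 + z) ^ (m - 1) * (1 - z) ^ (l - 1) = 0 := by
    refine (mul_eq_zero.1 h3.symm).resolve_left ?_
    have := hE.ne'
    positivity
  rcases mul_eq_zero.1 h4 with h5 | h5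
  · rw [eq_zero_of_pow_eq_zero h5, zero_mul]
  · rw [eq_zero_of_pow_eq_zero h5, mul_zero]

theorem resonanceParam_injOn (hl : 1 ≤ l) (hm : 1 ≤ m) (hE : 0 < E) :
    InjOn (resonanceParam l m E) (sphere 0 1) := by
  intro v hv w hw h
  have hl0 : (l : ℝ) ≠ 0 := by positivity
  rw [mem_unitSphere_iff] at hv hw
  obtain ⟨h1, h2⟩ := unitSphere_bounds hv
  have hz : v 2 = w 2 := by
    have := congrArg (fun A => A 0) h
    simpa [resonanceParam, hE.ne', hl0] using this
  have hx : v 0 * resonanceRadius l m E (v 2) = w 0 * resonanceRadius l m E (v 2) := by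
    have := congrArg (fun A => A 2) h
    simpa only [resonanceParam, PiLp.toLp_apply, Matrix.cons_val, ← hz] using this
  have hy : v 1 * resonanceRadius l m E (v 2) = w 1 * resonanceRadius l m E (v 2) := by
    have := congrArg (fun A => A 3) h
    simpa only [resonanceParam, PiLp.toLp_apply, Matrix.cons_val, ← hz] using this
  by_cases hg : resonanceRadius l m E (v 2) = 0
  · rw [← hz] at hw
    rw [resonanceRadius_eq_zero hl hm hE h1 h2 hg] at hv hw
    have hzero (u : EuclideanSpace ℝ (Fin 3)) (hu : u 0 ^ 2 + u 1 ^ 2 = 0) : u 0 = 0 ∧ u 1 = 0 := by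
      constructor <;> nlinarith [sq_nonneg (u 0), sq_nonneg (u 1)]
    ext i
    fin_cases i
    · exact (hzero v hv).1.trans (hzero w hw).1.symm
    · exact (hzero v hv).2.trans (hzero w hw).2.symm
    · exact hz
  · ext i
    fin_cases i
    · exact mul_right_cancel₀ hg hx
    · exact mul_right_cancel₀ hg hy
    · exact hz

theorem resonanceParam_surjOn (hl : 1 ≤ l) (hm : 1 ≤ m) (hE : 0 < E) :
    SurjOn (resonanceParam l m E) (sphere 0 1) (resonanceSurface l m E) := by
  rintro A ⟨hA0, hA1, hA2, hA3⟩
  have hl0 : (0 : ℝ) < l := by exact_mod_cast hl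
  have hm0 : (0 : ℝ) < m := by exact_mod_cast hm
  obtain ⟨z, hz⟩ : ∃ z : ℝ, z = 2 * l / E * A 0 - 1 := ⟨_, rfl⟩
  have e0 : A 0 = E / (2 * l) * (1 + z) := by
    rw [hz]
    field_simp
    ring
  have e1 : A 1 = E / (2 * m) * (1 - z) := by
    have : m * A 1 = E - l * A 0 := by linarith
    rw [e0] at this
    field_simp at this ⊢
    linarith
  have h1 : 0 ≤ 1 + z := by
    rw [hz]
    have : 0 ≤ 2 * l / E * A 0 := by positivity
    linarith
  have h2 : 0 ≤ 1 - z := by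
    have : 1 - z = 2 * m / E * A 1 := by
      rw [e1]
      field_simp
    rw [this]
    positivity
  have hr : A 2 ^ 2 + A 3 ^ 2 = (1 + z) * (1 - z) * resonanceRadius l m E z ^ 2 := by
    rw [hA3, resonanceRadius_sq hE h1 h2, e0, e1, mul_pow, mul_pow,
      ← mul_pow_sub_one (by lia : m ≠ 0) (1 + z), ← mul_pow_sub_one (by lia : l ≠ 0) (1 - z)]
    ring
  by_cases hg : resonanceRadius l m E z = 0
  · have h3 := resonanceRadius_eq_zero hl hm hE h1 h2 hg
    rw [h3, zero_mul] at hr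
    have h4 : A 2 = 0 := by nlinarith [sq_nonneg (A 2), sq_nonneg (A 3)]
    have h5 : A 3 = 0 := by nlinarith [sq_nonneg (A 2), sq_nonneg (A 3)]
    refine ⟨!₂[0, 0, z], (mem_unitSphere_iff _).2 (by simp [h3]), ?_⟩
    ext i
    fin_cases i <;> simp [resonanceParam, e0, e1, h4, h5]
  · refine ⟨!₂[A 2 / resonanceRadius l m E z, A 3 / resonanceRadius l m E z, z],
      (mem_unitSphere_iff _).2 ?_, ?_⟩
    · simp only [Matrix.cons_val]
      rw [div_pow, div_pow, ← add_div, hr, mul_div_cancel_right₀ _ (pow_ne_zero 2 hg)]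
    · ext i
      fin_cases i <;> simp [resonanceParam, e0, e1, hg]

/-- The parametrization of `Ω` by the sphere, as a homeomorphism. -/
noncomputable def resonanceHomeomorph (hl : 1 ≤ l) (hm : 1 ≤ m) (hE : 0 < E) :
    sphere (0 : EuclideanSpace ℝ (Fin 3)) 1 ≃ₜ resonanceSurface l m E :=
  Continuous.homeoOfEquivCompactToT2
    (f := BijOn.equiv (resonanceParam l m E) ⟨fun _ hv => resonanceParam_mem hl hm hE hv,
      resonanceParam_injOn hl hm hE, resonanceParam_surjOn hl hm hE⟩)
    ((continuous_resonanceParam.comp continuous_subtype_val).subtype_mk _)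

theorem coe_resonanceHomeomorph (hl : 1 ≤ l) (hm : 1 ≤ m) (hE : 0 < E)
    (v : sphere (0 : EuclideanSpace ℝ (Fin 3)) 1) :
    (resonanceHomeomorph hl hm hE v : EuclideanSpace ℝ (Fin 4)) = resonanceParam l m E v := rfl

theorem resonanceRadius_radicand_pos (hl : 1 ≤ l) (hm : 1 ≤ m) (hE : 0 < E)
    {v : EuclideanSpace ℝ (Fin 3)} (hv : v ∈ sphere (0 : EuclideanSpace ℝ (Fin 3)) 1)
    (hreg : resonanceParam l m E v ∈ resonanceRegularPart l m E) :
    0 < (E / (2 * l)) ^ m * (E / (2 * m)) ^ l * ((1 + v 2) ^ (m - 1) * (1 - v 2) ^ (l - 1)) := by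
  have hl0 : (0 : ℝ) < l := by exact_mod_cast hl
  have hm0 : (0 : ℝ) < m := by exact_mod_cast hm
  obtain ⟨-, hreg0, hreg1⟩ := hreg
  rw [mem_unitSphere_iff] at hv
  obtain ⟨h1, h2⟩ := unitSphere_bounds hv
  have e1 : 0 < (1 + v 2) ^ (m - 1) := by
    rcases hreg0 with rfl | h
    · simp
    · refine pow_pos (h1.lt_of_ne' fun h0 => h ?_) _
      simp [resonanceParam, h0]
  have e2 : 0 < (1 - v 2) ^ (l - 1) := by
    rcases hreg1 with rfl | h
    · simp
    · refine pow_pos (h2.lt_of_ne' fun h0 => h ?_) _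
      simp [resonanceParam, h0]
  positivity

theorem contDiffAt_resonanceRadius {z : ℝ}
    (h : 0 < (E / (2 * l)) ^ m * (E / (2 * m)) ^ l * ((1 + z) ^ (m - 1) * (1 - z) ^ (l - 1))) :
    ContDiffAt ℝ ∞ (resonanceRadius l m E) z := by
  unfold resonanceRadius
  refine ContDiffAt.sqrt ?_ h.ne'
  fun_prop

theorem contDiffAt_resonanceParam {v : EuclideanSpace ℝ (Fin 3)}
    (h : 0 < (E / (2 * l)) ^ m * (E / (2 * m)) ^ l
      * ((1 + v 2) ^ (m - 1) * (1 - v 2) ^ (l - 1))) :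
    ContDiffAt ℝ ∞ (resonanceParam l m E) v := by
  have hr : ContDiffAt ℝ ∞ (fun w : EuclideanSpace ℝ (Fin 3) => resonanceRadius l m E (w 2)) v :=
    (contDiffAt_resonanceRadius h).comp v (f := fun w : EuclideanSpace ℝ (Fin 3) => w 2)
      (by fun_prop)
  rw [contDiffAt_euclidean]
  intro i
  fin_cases i
  · change ContDiffAt ℝ ∞ (fun w : EuclideanSpace ℝ (Fin 3) => E / (2 * l) * (1 + w 2)) v
    fun_prop
  · change ContDiffAt ℝ ∞ (fun w : EuclideanSpace ℝ (Fin 3) => E / (2 * m) * (1 - w 2)) v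
    fun_prop
  · exact ContDiffAt.mul (f := fun w : EuclideanSpace ℝ (Fin 3) => w 0) (by fun_prop) hr
  · exact ContDiffAt.mul (f := fun w : EuclideanSpace ℝ (Fin 3) => w 1) (by fun_prop) hr

theorem fderiv_resonanceParam_injective (hl : 1 ≤ l) (hE : 0 < E)
    {v : EuclideanSpace ℝ (Fin 3)}
    (h : 0 < (E / (2 * l)) ^ m * (E / (2 * m)) ^ l
      * ((1 + v 2) ^ (m - 1) * (1 - v 2) ^ (l - 1))) :
    Function.Injective (fderiv ℝ (resonanceParam l m E) v) := by
  have hl0 : (0 : ℝ) < l := by exact_mod_cast hl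
  have hpos : 0 < resonanceRadius l m E (v 2) := Real.sqrt_pos.2 h
  have hF := ((contDiffAt_resonanceParam h).differentiableAt (by simp)).hasFDerivAt
  have hFi (i : Fin 4) : HasFDerivAt (fun w => resonanceParam l m E w i) _ v :=
    (EuclideanSpace.proj (𝕜 := ℝ) i).hasFDerivAt.comp v hF
  have hproj (i : Fin 3) : HasFDerivAt (fun w : EuclideanSpace ℝ (Fin 3) => w i)
      (EuclideanSpace.proj i : EuclideanSpace ℝ (Fin 3) →L[ℝ] ℝ) v :=
    (EuclideanSpace.proj (𝕜 := ℝ) i).hasFDerivAt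
  have hd := ((contDiffAt_resonanceRadius h).differentiableAt (by simp)).hasDerivAt
  have hR := hd.comp_hasFDerivAt v (hproj 2)
  rw [injective_iff_map_eq_zero]
  intro u hu
  have h2 : u 2 = 0 := by
    have := congrArg (fun T => T u) ((hFi 0).unique (((hproj 2).const_add 1).const_mul (E / (2 * l))))
    simpa [hu, hE.ne', hl0.ne'] using this
  have h0 : u 0 = 0 := by
    have := congrArg (fun T => T u) ((hFi 2).unique ((hproj 0).fun_mul hR))
    simpa [hu, h2, hpos.ne'] using this
  have h1 : u 1 = 0 := by
    have := congrArg (fun T => T u) ((hFi 3).unique ((hproj 1).fun_mul hR))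
    simpa [hu, h2, hpos.ne'] using this
  ext i
  fin_cases i
  · exact h0
  · exact h1
  · exact h2

/-- With the smooth structure carried over from the sphere, the inclusion of `Ω` is an immersion at
the regular points. -/
theorem exists_resonance_smooth_structure (hl : 1 ≤ l) (hm : 1 ≤ m) (hE : 0 < E) :
    ∃ _ : ChartedSpace (EuclideanSpace ℝ (Fin 2)) (resonanceSurface l m E),
      IsManifold (𝓡 2) ∞ (resonanceSurface l m E) ∧
      (∀ p : resonanceSurface l m E,
        (p : EuclideanSpace ℝ (Fin 4)) ∈ resonanceRegularPart l m E →
        ContMDiffAt (𝓡 2) 𝓘(ℝ, EuclideanSpace ℝ (Fin 4)) ∞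
          (Subtype.val : resonanceSurface l m E → EuclideanSpace ℝ (Fin 4)) p ∧
        Function.Injective (mfderiv (𝓡 2) 𝓘(ℝ, EuclideanSpace ℝ (Fin 4))
          (Subtype.val : resonanceSurface l m E → EuclideanSpace ℝ (Fin 4)) p)) ∧
      Nonempty (Diffeomorph (𝓡 2) (𝓡 2) (resonanceSurface l m E)
        (sphere (0 : EuclideanSpace ℝ (Fin 3)) 1) ∞) := by
  let e := (resonanceHomeomorph (l := l) (m := m) hl hm hE).symm
  have : IsManifold (𝓡 2) ∞ (sphere (0 : EuclideanSpace ℝ (Fin 3)) 1) :=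
    EuclideanSpace.instIsManifoldSphere.of_le le_top
  let : ChartedSpace (EuclideanSpace ℝ (Fin 2)) (resonanceSurface l m E) := e.pullbackChartedSpace
  let Φ : Diffeomorph (𝓡 2) (𝓡 2) (resonanceSurface l m E)
    (sphere (0 : EuclideanSpace ℝ (Fin 3)) 1) ∞ := e.pullbackDiffeomorph (𝓡 2) ∞
  refine ⟨inferInstance, e.isManifold_pullbackChartedSpace (𝓡 2) ∞, fun p hp => ?_, ⟨Φ⟩⟩
  have hval : (Subtype.val : resonanceSurface l m E → EuclideanSpace ℝ (Fin 4))
      = resonanceParam l m E ∘ ((↑) : sphere (0 : EuclideanSpace ℝ (Fin 3)) 1 → _) ∘ Φ := by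
    funext q
    exact (congrArg Subtype.val (e.symm_apply_apply q)).symm.trans
      (coe_resonanceHomeomorph hl hm hE (e q))
  have hpos := resonanceRadius_radicand_pos hl hm hE (Φ p).2 (by
    have := congrFun hval p
    simp only [Function.comp_apply] at this
    rwa [← this])
  have hF : ContMDiffAt 𝓘(ℝ, EuclideanSpace ℝ (Fin 3)) 𝓘(ℝ, EuclideanSpace ℝ (Fin 4)) ∞
      (resonanceParam l m E) (Φ p : EuclideanSpace ℝ (Fin 3)) :=
    (contDiffAt_resonanceParam hpos).contMDiffAt
  have hι : ContMDiffAt (𝓡 2) 𝓘(ℝ, EuclideanSpace ℝ (Fin 3)) ∞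
      ((↑) : sphere (0 : EuclideanSpace ℝ (Fin 3)) 1 → EuclideanSpace ℝ (Fin 3)) (Φ p) :=
    contMDiff_coe_sphere.contMDiffAt
  have hΦ : ContMDiffAt (𝓡 2) (𝓡 2) ∞ Φ p := Φ.contMDiff.contMDiffAt
  have hιΦ := hι.comp p hΦ
  rw [hval]
  refine ⟨hF.comp p hιΦ, ?_⟩
  rw [mfderiv_comp p (hF.mdifferentiableAt (by simp)) (hιΦ.mdifferentiableAt (by simp)),
    mfderiv_comp p (hι.mdifferentiableAt (by simp)) (hΦ.mdifferentiableAt (by simp))]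
  have i1 : Function.Injective (mfderiv 𝓘(ℝ, EuclideanSpace ℝ (Fin 3))
      𝓘(ℝ, EuclideanSpace ℝ (Fin 4)) (resonanceParam l m E) (Φ p : EuclideanSpace ℝ (Fin 3))) := by
    rw [mfderiv_eq_fderiv]
    exact fderiv_resonanceParam_injective hl hE hpos
  have i3 : Function.Injective (mfderiv (𝓡 2) (𝓡 2) Φ p) :=
    (Φ.mfderivToContinuousLinearEquiv (by simp) p).injective
  exact i1.comp ((injective_mvfderiv_subtypeVal_sphere (Φ p)).comp i3)

end

/-! ### The topology of the leaf -/

theorem lemma2p4 (l m : ℕ) (hl : 1 ≤ l) (hm : 1 ≤ m) (hlm : Nat.Coprime l m)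
    (E : ℝ) (hE : 0 < E) :
    ∃ Ω₀ : Set (EuclideanSpace ℝ (Fin 4)),
      -- `Ω` is the closure of the symplectic leaf `Ω₀`, and of no other leaf
      (resonancePoisson l m).IsSymplecticLeaf Ω₀ ∧
      closure Ω₀ = resonanceSurface l m E ∧
      (∀ L, (resonancePoisson l m).IsSymplecticLeaf L →
        closure L = resonanceSurface l m E → L = Ω₀) ∧
      -- `Ω` is diffeomorphic to the sphere, for a smooth structure on the space `Ω` in which
      -- the inclusion into `ℝ⁴` is a smooth immersion at all points of `Ω₀`
      (∃ _ : ChartedSpace (EuclideanSpace ℝ (Fin 2)) (resonanceSurface l m E),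
        IsManifold (𝓡 2) ∞ (resonanceSurface l m E) ∧
        (∀ p : resonanceSurface l m E, (p : EuclideanSpace ℝ (Fin 4)) ∈ Ω₀ →
          ContMDiffAt (𝓡 2) 𝓘(ℝ, EuclideanSpace ℝ (Fin 4)) ∞
            (Subtype.val : resonanceSurface l m E → EuclideanSpace ℝ (Fin 4)) p ∧
          Function.Injective (mfderiv (𝓡 2) 𝓘(ℝ, EuclideanSpace ℝ (Fin 4))
            (Subtype.val : resonanceSurface l m E → EuclideanSpace ℝ (Fin 4)) p)) ∧
        Nonempty (Diffeomorph (𝓡 2) (𝓡 2) (resonanceSurface l m E)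
          (sphere (0 : EuclideanSpace ℝ (Fin 3)) 1) ∞)) ∧
      -- the topology of the leaf
      (l = 1 → m = 1 → Ω₀ = resonanceSurface l m E) ∧
      (l = 1 → 1 < m → Ω₀ = resonanceSurface l m E \ {!₂[0, E / m, 0, 0]}) ∧
      (1 < l → m = 1 → Ω₀ = resonanceSurface l m E \ {!₂[E / l, 0, 0, 0]}) ∧
      (1 < l → 1 < m →
        Ω₀ = resonanceSurface l m E \ {!₂[0, E / m, 0, 0], !₂[E / l, 0, 0, 0]}) := by
  refine ⟨resonanceRegularPart l m E,
    ⟨_, (resonance_leaf_eq hl hm hE (resonanceMeridian_pi_div_four_mem hl hm hE)).symm⟩,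
    closure_resonanceRegularPart hl hm hE,
    fun L hL hc => eq_resonanceRegularPart_of_closure_eq hl hm hE hL hc,
    exists_resonance_smooth_structure hl hm hE, ?_, ?_, ?_, ?_⟩
  · rintro rfl rfl
    ext A
    simp [resonanceRegularPart]
  · rintro rfl hm1
    ext A
    refine and_congr_right fun hA => ?_
    simp [resonanceSurface_coord_zero_eq_zero_iff hm hA, hm1.ne']
  · rintro hl1 rfl
    ext A
    refine and_congr_right fun hA => ?_
    simp [resonanceSurface_coord_one_eq_zero_iff hl hA, hl1.ne']
  · intro hl1 hm1
    ext A
    refine and_congr_right fun hA => ?_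
    simp [resonanceSurface_coord_zero_eq_zero_iff hm hA,
      resonanceSurface_coord_one_eq_zero_iff hl hA, hl1.ne', hm1.ne']
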